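/- Fix integers $n,\ell\ge 0$. Let $\mathcal G_1$ be the set of pairs $(G,v)$, where $G$ is an undirected simple graph with vertex set $V_G=[n]$ and a vertex labelling $\mathsf{col}_G:V_G\to\mathbb R^\ell$, and $v\in V_G$. For a set $\mathcal F$ of functions on $\mathcal G_1$ let $\rho_1(\mathcal F)=\{((G,v),(H,w)) : f(G,v)=f(H,w)\text{ for all } f\in\mathcal F\}$, and for a single function $f$ on $\mathcal G_1$ write $\rho_1(f)=\rho_1(\{f\})$. Weisfeiler–Leman. The atomic type $\mathsf{atp}_k(G,\mathbf v)$ of a tuple $\mathbf v\in V_G^k$ consists of the truth values of $v_i=v_j$ and of $v_iv_j\in E_G$ for $1\le i<j\le k$, and the labels $\mathsf{col}_G(v_i)$ for $1\le i\le k$. Put $\mathsf{wl}_k^{(0)}(G,\mathbf v)=\mathsf{atp}_k(G,\mathbf v)$ and, for $t\ge 0$, $\mathsf{wl}_k^{(t+1)}(G,\mathbf v)=(\mathsf{wl}_k^{(t)}(G,\mathbf v),M)$ with the multiset $$M=\{\!\{(\mathsf{atp}_{k+1}(G,\mathbf v u),\mathsf{wl}_k^{(t)}(G,\mathbf v[u/1]),\ldots,\mathsf{wl}_k^{(t)}(G,\mathbf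 v[u/k])) : u\in V_G\}\!\},$$ where $\mathbf v u=(v_1,\ldots,v_k,u)$ and $\mathbf v[u/i]$ is $\mathbf v$ with its $i$-th entry replaced by $u$. Put $\mathsf{vwl}_k^{(t)}(G,v)=\mathsf{wl}_k^{(t)}(G,(v,\ldots,v))$, and let $\mathsf{vwl}_k^{(\infty)}$ be the stable labelling: $\mathsf{vwl}_k^{(\infty)}(G,v)=\mathsf{vwl}_k^{(\infty)}(H,w)$ if and only if $\mathsf{vwl}_k^{(t)}(G,v)=\mathsf{vwl}_k^{(t)}(H,w)$ for all $t\ge 0$. Tensor language. Let $\Omega$ be a collection of functions $f:\mathbb R^p\to\mathbb R$ (with $p$ depending on $f$). $\mathsf{TL}_{k+1}(\Omega)$ is the set of expressions over the index variables $x_1,\ldots,x_{k+1}$ given by $$\varphi ::= \mathbf 1_{x=y}\mid \mathbf 1_{x\ne y}\mid E(x,y)\mid P_s(x)\mid \varphi\cdot\varphi\mid\varphi+\varphi\mid a\cdot\varphi\mid f(\varphi,\ldots,\varphi)\mid \textstyle\sum_x\varphi,$$ with $s\in[\ell]$, $a\in\mathbb R$, $f\in\Omega$. In a graph $G$, under a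 valuation $\nu$ of the index variables in $V_G$, $\mathbf 1_{x=y}$, $\mathbf 1_{x\neq y}$ and $E(x,y)$ take the value $1$ or $0$ according to whether $\nu(x)=\nu(y)$, $\nu(x)\ne\nu(y)$ and $\nu(x)\nu(y)\in E_G$, respectively; $P_s(x)$ has the value $\mathsf{col}_G(\nu(x))_s$; products, sums, scalar multiples and applications of $f$ are computed on the values; and $\sum_x\varphi$ has the value $\sum_{v\in V_G}[\![\varphi]\!]_G^{\nu[x\mapsto v]}$. Here $\sum_x$ binds $x$; all other occurrences of variables are free. If $\varphi$ has no free variable other than $x_1$, then $[\![\varphi]\!]_G^{v}$ denotes its value under any valuation with $x_1\mapsto v$. Let $\rho_1(\mathsf{TL}_{k+1}(\Omega))$ be $\rho_1$ of the set of all functions $\mathcal G_1\to\mathbb R^d$, $d\in\mathbb N$, of the form $(G,v)\mapsto([\![\varphi_1]\!]_G^{v},\ldots,[\![\varphi_d]\!]_G^{v})$ with $\varphi_1,\ldots,\varphi_d\in\mathsf{TL}_{k+1}(\Omega)$ having no free variable other than $x_1$. Theorem. For every $k\ge 1$ and every collection $\Omega$ of functions, $$\rho_1\bigl(\mathsf{vwl}_k^{(\infty)}\bigr)=\rho_1\bigl(\mathsf{TL}_{k+1}(\Omega)\bigr).$$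 -/

import Mathlib

namespace TensorLang

open scoped Classical in
/-- The value of a `0/1` entry: `1` if `p` holds and `0` otherwise. -/
noncomputable def ind (p : Prop) : ℝ := if p then 1 else 0

/-- Undirected simple graphs on the vertex set `[n]` whose vertices carry labels in `ℝ^ℓ`. -/
structure LabeledGraph (n ℓ : ℕ) where
  /-- the edges -/
  graph : SimpleGraph (Fin n)
  /-- the vertex-labelling -/
  col : Fin n → Fin ℓ → ℝ

/-- Pairs `(G, v)` of a labelled graph of size `n` and a vertex `v` of it. -/
abbrev PointedGraph (n ℓ : ℕ) : Type := LabeledGraph n ℓ × Fin n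

/-! ### Separation power -/

/-- The equivalence relation defined by a set of functions (each with its own codomain):
two points are related when no function of the set separates them. -/
def rho {α : Type} (F : Set (Σ β : Type, α → β)) : Setoid α where
  r a b := ∀ f ∈ F, f.2 a = f.2 b
  iseqv := ⟨fun _ _ _ => rfl, fun h f hf => (h f hf).symm,
    fun h₁ h₂ f hf => (h₁ f hf).trans (h₂ f hf)⟩

/-! ### The `k`-dimensional (folklore) Weisfeiler-Leman algorithm -/

/-- The pairs `(i, j)` of positions of a `k`-tuple with `i < j`. -/
abbrev PosPair (k : ℕ) : Type := {p : Fin k × Fin k // p.1 < p.2}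

/-- Atomic types of `k`-tuples: one real entry for every pair `i < j` (equality),
one for every pair `i < j` (adjacency), and `k` vertex labels in `ℝ^ℓ`. -/
abbrev AtomicType (k ℓ : ℕ) : Type :=
  (PosPair k → ℝ) × (PosPair k → ℝ) × (Fin k → Fin ℓ → ℝ)

/-- The atomic type of the tuple `v` in `G`. -/
noncomputable def atp {n ℓ k : ℕ} (G : LabeledGraph n ℓ) (v : Fin k → Fin n) :
    AtomicType k ℓ :=
  (fun p => ind (v p.1.1 = v p.1.2),
   fun p => ind (G.graph.Adj (v p.1.1) (v p.1.2)),
   fun i => G.col (v i))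

/-- The labels that the algorithm assigns in round `t`. -/
def WLLabel (k ℓ : ℕ) : ℕ → Type
  | 0 => AtomicType k ℓ
  | t + 1 => WLLabel k ℓ t × Multiset (AtomicType (k + 1) ℓ × (Fin k → WLLabel k ℓ t))

/-- The label of the `k`-tuple `v` of vertices of `G` after `t` rounds.  Here `Fin.snoc v u` is
the `(k+1)`-tuple `v u`, and `Function.update v i u` is `v` with `i`-th entry replaced by `u`. -/
noncomputable def wl {n ℓ : ℕ} (k : ℕ) (G : LabeledGraph n ℓ) :
    (t : ℕ) → (Fin k → Fin n) → WLLabel k ℓ t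
  | 0, v => atp G v
  | t + 1, v =>
      (wl k G t v,
       (Finset.univ : Finset (Fin n)).val.map fun u =>
         (atp G (Fin.snoc v u : Fin (k + 1) → Fin n),
          fun i : Fin k => wl k G t (Function.update v i u)))

/-- The vertex labelling after `t` rounds: the label of the constant tuple `(v, …, v)`. -/
noncomputable def vwl {n ℓ : ℕ} (k t : ℕ) (p : PointedGraph n ℓ) : WLLabel k ℓ t :=
  wl k p.1 t (fun _ => p.2)

/-- The stable vertex labelling: it records the labels over arbitrarily many rounds, so that two
vertices (of the same or of different graphs) have the same stable label precisely when no
number of rounds tells them apart. -/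
noncomputable def vwlStable {n ℓ : ℕ} (k : ℕ) (p : PointedGraph n ℓ) :
    (t : ℕ) → WLLabel k ℓ t :=
  fun t => vwl k t p

/-! ### Tensor language -/

/-- Collections of real-valued functions of finitely many real arguments, of any arities. -/
abbrev FunCollection : Type := Set (Σ p : ℕ, (Fin p → ℝ) → ℝ)

/-- Tensor language expressions over the functions in `Ω`, the vertex predicates
`P_s` (`s ∈ [ℓ]`) and the index variables `X`. -/
inductive TL (Ω : FunCollection) (ℓ : ℕ) (X : Type) : Type
  /-- the equality indicator of `x` and `y` -/
  | eq (x y : X) : TL Ω ℓ X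
  /-- the disequality indicator of `x` and `y` -/
  | ne (x y : X) : TL Ω ℓ X
  /-- `E(x, y)` -/
  | edge (x y : X) : TL Ω ℓ X
  /-- `P_s(x)` -/
  | pred (s : Fin ℓ) (x : X) : TL Ω ℓ X
  /-- product -/
  | mul (φ ψ : TL Ω ℓ X) : TL Ω ℓ X
  /-- sum of two expressions -/
  | plus (φ ψ : TL Ω ℓ X) : TL Ω ℓ X
  /-- multiplication by a real constant -/
  | scale (a : ℝ) (φ : TL Ω ℓ X) : TL Ω ℓ X
  /-- application of a function of `Ω` -/
  | app (p : ℕ) (f : (Fin p → ℝ) → ℝ) (hf : (⟨p, f⟩ : Σ p : ℕ, (Fin p → ℝ) → ℝ) ∈ Ω)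
      (φ : Fin p → TL Ω ℓ X) : TL Ω ℓ X
  /-- summation over the index variable `x` -/
  | sum (x : X) (φ : TL Ω ℓ X) : TL Ω ℓ X

/-- The `m`-index variable fragment: only the index variables `x_1, …, x_m` are available
(the variable `x_{i+1}` is the element `i` of `Fin m`). -/
abbrev TLVar (Ω : FunCollection) (ℓ m : ℕ) : Type := TL Ω ℓ (Fin m)

/-- The free index variables of an expression. -/
def TL.free {Ω : FunCollection} {ℓ : ℕ} {X : Type} : TL Ω ℓ X → Set X
  | .eq x y => {x, y}
  | .ne x y => {x, y}
  | .edge x y => {x, y}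
  | .pred _ x => {x}
  | .mul φ ψ => φ.free ∪ ψ.free
  | .plus φ ψ => φ.free ∪ ψ.free
  | .scale _ φ => φ.free
  | .app _ _ _ φ => ⋃ i, (φ i).free
  | .sum x φ => φ.free \ {x}

/-- The value of an expression in `G` under the valuation `ν`. -/
noncomputable def TL.eval {Ω : FunCollection} {ℓ n : ℕ} {X : Type} [DecidableEq X]
    (G : LabeledGraph n ℓ) : TL Ω ℓ X → (X → Fin n) → ℝ
  | .eq x y, ν => ind (ν x = ν y)
  | .ne x y, ν => ind (ν x ≠ ν y)
  | .edge x y, ν => ind (G.graph.Adj (ν x) (ν y))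
  | .pred s x, ν => G.col (ν x) s
  | .mul φ ψ, ν => φ.eval G ν * ψ.eval G ν
  | .plus φ ψ, ν => φ.eval G ν + ψ.eval G ν
  | .scale a φ, ν => a * φ.eval G ν
  | .app _ f _ φ, ν => f fun i => (φ i).eval G ν
  | .sum x φ, ν => ∑ v : Fin n, φ.eval G (Function.update ν x v)

/-- The function `f` on pointed graphs, with values in `ℝ^d`, is represented by `d` expressions
`φ_1(x_1), …, φ_d(x_1)` that use at most `k + 1` index variables; the value of such an expression
at a vertex `v` is its value under any valuation that sends `x_1` to `v`. -/
def IsRepresented {n ℓ d : ℕ} (Ω : FunCollection) (k : ℕ)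
    (f : PointedGraph n ℓ → Fin d → ℝ) : Prop :=
  ∃ φ : Fin d → TLVar Ω ℓ (k + 1), (∀ i, (φ i).free ⊆ {0}) ∧
    ∀ (G : LabeledGraph n ℓ) (v : Fin n) (ν : Fin (k + 1) → Fin n), ν 0 = v →
      ∀ i, f (G, v) i = (φ i).eval G ν

/-- All functions on pointed graphs, of any finite output dimension, that are represented
by expressions with `k + 1` index variables. -/
def representedFunctions (n ℓ : ℕ) (Ω : FunCollection) (k : ℕ) :
    Set (Σ β : Type, PointedGraph n ℓ → β) :=
  {F | ∃ (d : ℕ) (f : PointedGraph n ℓ → Fin d → ℝ),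
    IsRepresented Ω k f ∧ F = ⟨Fin d → ℝ, f⟩}

end TensorLang

/-!
Both inclusions go through valuations of all `k + 1` index variables, that is, `(k + 1)`-tuples of
vertices; the first `k` entries of such a tuple are a `k`-tuple that the algorithm labels, and the
other `k`-subtuples are reached by exchanging an entry with the last one.

*Weisfeiler-Leman bounds the tensor language.* Two `(k + 1)`-tuples agree up to round `t` when they
have the same atomic type and all their corresponding `k`-subtuples have the same label of round
`t` (`AgreeUpTo`). If they agree up to round `t + 1`, then for each variable `x` there is a
bijection between the vertices such that the tuples still agree up to round `t` once the value of
`x` is replaced along it (`AgreeUpTo.exists_update`): this is what equality of the multisets says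
when `x` is the last variable, and the general case follows as labels are equivariant under
permutations of the positions (`wl_comp_perm`). Hence sums over `x` are matched term by term, and
every expression has equal values on tuples that agree up to a sufficiently late round
(`eventually_eval_eq`).

*The tensor language bounds Weisfeiler-Leman.* For finitely many graphs, the values of expressions
form a subalgebra of the real functions on a finite set of tuples, so it contains the indicator
function of each class of tuples that no expression separates (`exists_mem_indicator`). Summing
these indicators over the last variable counts how often each class occurs, so that inseparable
tuples have a bijection between their one-entry modifications that respects inseparability
(`Inseparable.exists_update`). As inseparability is also preserved by permuting variables, it
implies equality of the labels of every round (`Inseparable.wl_eq`). Finally, any expression can be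
evaluated at a constant tuple `(v, …, v)` by an expression whose only free variable is `x_1`,
namely by summing out the other variables against equality indicators (`exists_diagonal`).
-/

namespace TensorLang

open Filter Function

/-! ### Atomic types -/

theorem ind_eq_ind {p q : Prop} : ind p = ind q ↔ (p ↔ q) := by
  unfold ind
  by_cases hp : p <;> by_cases hq : q <;> simp [hp, hq]

variable {n ℓ k : ℕ} {Ω : FunCollection}

theorem atp_eq_iff {m : ℕ} {G H : LabeledGraph n ℓ} {v w : Fin m → Fin n} :
    atp G v = atp H w ↔
      (∀ i j, v i = v j ↔ w i = w j) ∧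
      (∀ i j, G.graph.Adj (v i) (v j) ↔ H.graph.Adj (w i) (w j)) ∧
      ∀ i, G.col (v i) = H.col (w i) := by
  simp only [atp, Prod.mk.injEq, funext_iff (α := PosPair m), ind_eq_ind, funext_iff (α := Fin m)]
  refine and_congr ⟨fun h i j => ?_, fun h p => h _ _⟩
    (and_congr ⟨fun h i j => ?_, fun h p => h _ _⟩ Iff.rfl)
  · rcases lt_trichotomy i j with hij | rfl | hij
    · exact h ⟨(i, j), hij⟩
    · simp
    · rw [eq_comm, h ⟨(j, i), hij⟩, eq_comm]
  · rcases lt_trichotomy i j with hij | rfl | hij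
    · exact h ⟨(i, j), hij⟩
    · simp
    · rw [G.graph.adj_comm, h ⟨(j, i), hij⟩, H.graph.adj_comm]

theorem atp_comp {m m' : ℕ} {G H : LabeledGraph n ℓ} {v w : Fin m → Fin n}
    (h : atp G v = atp H w) (σ : Fin m' → Fin m) : atp G (v ∘ σ) = atp H (w ∘ σ) := by
  rw [atp_eq_iff] at h ⊢
  exact ⟨fun i j => h.1 _ _, fun i j => h.2.1 _ _, fun i => h.2.2 _⟩

/-! ### Equality of multisets of values -/

theorem multiset_map_univ_eq_iff {α β : Type*} [Fintype α] {f g : α → β} :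
    (Finset.univ : Finset α).val.map f = (Finset.univ : Finset α).val.map g ↔
      ∃ e : Equiv.Perm α, ∀ a, f a = g (e a) := by
  classical
  constructor
  · intro h
    have hcard (b : β) : Nonempty ({a // f a = b} ≃ {a // g a = b}) := by
      have hb := congrArg (Multiset.count b) h
      rw [Multiset.count_map, Multiset.count_map] at hb
      rw [← Fintype.card_eq, Fintype.card_subtype, Fintype.card_subtype]
      simp only [eq_comm (a := b)] at hb
      exact hb
    exact ⟨Equiv.ofFiberEquiv fun b => (hcard b).some,
      fun a => (Equiv.ofFiberEquiv_map _ a).symm⟩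
  · rintro ⟨e, he⟩
    conv_rhs => rw [← Multiset.map_univ_val_equiv e, Multiset.map_map]
    exact Multiset.map_congr rfl fun a _ => he a

/-! ### Labels of the Weisfeiler-Leman algorithm -/

/-- Equality of labels as a statement about a bijection between the vertices. -/
theorem wl_succ_eq_iff {G H : LabeledGraph n ℓ} {t : ℕ} {v w : Fin k → Fin n} :
    wl k G (t + 1) v = wl k H (t + 1) w ↔ wl k G t v = wl k H t w ∧
      ∃ e : Equiv.Perm (Fin n), ∀ u,
        atp G (Fin.snoc v u : Fin (k + 1) → Fin n) = atp H (Fin.snoc w (e u)) ∧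
        ∀ i, wl k G t (update v i u) = wl k H t (update w i (e u)) := by
  refine Prod.mk_inj.trans (and_congr Iff.rfl (multiset_map_univ_eq_iff.trans ?_))
  simp only [Prod.mk.injEq, funext_iff (α := Fin k)]

theorem wl_comp_perm {G H : LabeledGraph n ℓ} (π : Equiv.Perm (Fin k)) {t : ℕ}
    {v w : Fin k → Fin n} (h : wl k G t v = wl k H t w) :
    wl k G t (v ∘ π) = wl k H t (w ∘ π) := by
  induction t generalizing v w with
  | zero => exact atp_comp h π
  | succ t ih =>
    have update_comp (v : Fin k → Fin n) (i : Fin k) (u : Fin n) :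
        update (v ∘ π) i u = update v (π i) u ∘ π := by
      rw [update_comp_eq_of_injective _ π.injective]
    have snoc_comp (v : Fin k → Fin n) (u : Fin n) :
        (Fin.snoc (v ∘ π) u : Fin (k + 1) → Fin n) =
          (Fin.snoc v u : Fin (k + 1) → Fin n) ∘
            (Fin.snoc (Fin.castSucc ∘ π) (Fin.last k) : Fin (k + 1) → Fin (k + 1)) := by
      ext i
      refine Fin.lastCases ?_ (fun i => ?_) i <;> simp
    rw [wl_succ_eq_iff] at h ⊢
    obtain ⟨h₀, e, he⟩ := h
    refine ⟨ih h₀, e, fun u => ⟨?_, fun i => ?_⟩⟩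
    · rw [snoc_comp, snoc_comp]
      exact atp_comp (he u).1 _
    · rw [update_comp, update_comp]
      exact ih ((he u).2 _)

/-! ### Agreement of tuples with one more entry -/

theorem init_comp_swap_last (ν : Fin (k + 1) → Fin n) (j : Fin k) :
    Fin.init (ν ∘ Equiv.swap j.castSucc (Fin.last k)) =
      update (Fin.init ν) j (ν (Fin.last k)) := by
  ext i
  by_cases h : i = j
  · subst h
    simp [Fin.init]
  · have h' : i.castSucc ≠ j.castSucc := fun hc => h (Fin.castSucc_injective k hc)
    simp [Fin.init, h, Equiv.swap_apply_of_ne_of_ne h' (Fin.castSucc_lt_last i).ne]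

theorem update_last (ν : Fin (k + 1) → Fin n) (u : Fin n) :
    update ν (Fin.last k) u = (Fin.snoc (Fin.init ν) u : Fin (k + 1) → Fin n) := by
  rw [← Fin.update_snoc_last (x := ν (Fin.last k)), Fin.snoc_init_self]

theorem update_comp_swap_last (ν : Fin (k + 1) → Fin n) (i : Fin (k + 1)) (u : Fin n) :
    update ν i u =
      update (ν ∘ Equiv.swap i (Fin.last k)) (Fin.last k) u ∘ Equiv.swap i (Fin.last k) := by
  have h := update_comp_eq_of_injective (ν ∘ Equiv.swap i (Fin.last k))
    (Equiv.swap i (Fin.last k)).injective i u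
  rw [Equiv.swap_apply_left] at h
  rw [h]
  congr 1
  ext j
  simp

/-- A permutation of `k + 1` positions that fixes the last one permutes the first `k`. -/
theorem exists_perm_init {τ : Equiv.Perm (Fin (k + 1))} (hτ : τ (Fin.last k) = Fin.last k) :
    ∃ π : Equiv.Perm (Fin k), ∀ j, τ j.castSucc = (π j).castSucc := by
  have h (j : Fin k) : ∃ i : Fin k, i.castSucc = τ j.castSucc := by
    refine Fin.exists_castSucc_eq.2 fun hj => (Fin.castSucc_lt_last j).ne (τ.injective ?_)
    rw [hj, hτ]
  choose f hf using h
  have hinj : Injective f := fun i j hij =>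
    Fin.castSucc_injective k (τ.injective (by rw [← hf, ← hf, hij]))
  exact ⟨Equiv.ofBijective f (Finite.injective_iff_bijective.1 hinj), fun j => (hf j).symm⟩

/-- Two `(k + 1)`-tuples agree up to round `t` when their atomic types are equal and so are the
labels of round `t` of the `k`-tuples obtained by deleting an entry. Entry `i` is deleted by moving
the last entry into its place. -/
def AgreeUpTo (t : ℕ) (G H : LabeledGraph n ℓ) (ν μ : Fin (k + 1) → Fin n) : Prop :=
  atp G ν = atp H μ ∧ ∀ i, wl k G t (Fin.init (ν ∘ Equiv.swap i (Fin.last k))) =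
    wl k H t (Fin.init (μ ∘ Equiv.swap i (Fin.last k)))

theorem AgreeUpTo.comp_perm {t : ℕ} {G H : LabeledGraph n ℓ} {ν μ : Fin (k + 1) → Fin n}
    (h : AgreeUpTo t G H ν μ) (σ : Equiv.Perm (Fin (k + 1))) :
    AgreeUpTo t G H (ν ∘ σ) (μ ∘ σ) := by
  refine ⟨atp_comp h.1 σ, fun i => ?_⟩
  -- Deleting entry `i` after `σ` is deleting entry `σ i` first, up to a permutation of the rest.
  set τ : Equiv.Perm (Fin (k + 1)) :=
    Equiv.swap (σ i) (Fin.last k) * σ * Equiv.swap i (Fin.last k) with hτ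
  obtain ⟨π, hπ⟩ := exists_perm_init (τ := τ) (by simp [hτ])
  have key (ν : Fin (k + 1) → Fin n) :
      Fin.init ((ν ∘ σ) ∘ Equiv.swap i (Fin.last k)) =
        Fin.init (ν ∘ Equiv.swap (σ i) (Fin.last k)) ∘ π := by
    ext j
    simp [Fin.init, ← hπ, hτ]
  rw [key, key]
  exact wl_comp_perm π (h.2 (σ i))

theorem exists_agreeUpTo_update_last {t : ℕ} {G H : LabeledGraph n ℓ} {ν μ : Fin (k + 1) → Fin n}
    (h : wl k G (t + 1) (Fin.init ν) = wl k H (t + 1) (Fin.init μ)) :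
    ∃ e : Equiv.Perm (Fin n), ∀ u,
      AgreeUpTo t G H (update ν (Fin.last k) u) (update μ (Fin.last k) (e u)) := by
  obtain ⟨h₀, e, he⟩ := wl_succ_eq_iff.1 h
  refine ⟨e, fun u => ?_⟩
  rw [update_last, update_last]
  refine ⟨(he u).1, Fin.lastCases ?_ fun i => ?_⟩
  · simpa using h₀
  · simpa [init_comp_swap_last] using (he u).2 i

theorem AgreeUpTo.exists_update {t : ℕ} {G H : LabeledGraph n ℓ} {ν μ : Fin (k + 1) → Fin n}
    (h : AgreeUpTo (t + 1) G H ν μ) (i : Fin (k + 1)) :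
    ∃ e : Equiv.Perm (Fin n), ∀ u, AgreeUpTo t G H (update ν i u) (update μ i (e u)) := by
  obtain ⟨e, he⟩ := exists_agreeUpTo_update_last (h.2 i)
  refine ⟨e, fun u => ?_⟩
  rw [update_comp_swap_last ν, update_comp_swap_last μ]
  exact (he u).comp_perm _

/-- An expression cannot separate tuples that agree up to a late enough round. -/
theorem eventually_eval_eq (φ : TLVar Ω ℓ (k + 1)) :
    ∀ᶠ t in atTop, ∀ (G H : LabeledGraph n ℓ) (ν μ : Fin (k + 1) → Fin n),
      AgreeUpTo t G H ν μ → φ.eval G ν = φ.eval H μ := by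
  induction φ with
  | eq x y =>
    exact .of_forall fun t G H ν μ h => ind_eq_ind.2 ((atp_eq_iff.1 h.1).1 x y)
  | ne x y =>
    exact .of_forall fun t G H ν μ h => ind_eq_ind.2 (not_congr ((atp_eq_iff.1 h.1).1 x y))
  | edge x y =>
    exact .of_forall fun t G H ν μ h => ind_eq_ind.2 ((atp_eq_iff.1 h.1).2.1 x y)
  | pred s x =>
    exact .of_forall fun t G H ν μ h => congrFun ((atp_eq_iff.1 h.1).2.2 x) s
  | mul φ ψ ihφ ihψ =>
    filter_upwards [ihφ, ihψ] with t hφ hψ G H ν μ h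
    simp only [TL.eval, hφ G H ν μ h, hψ G H ν μ h]
  | plus φ ψ ihφ ihψ =>
    filter_upwards [ihφ, ihψ] with t hφ hψ G H ν μ h
    simp only [TL.eval, hφ G H ν μ h, hψ G H ν μ h]
  | scale a φ ih =>
    filter_upwards [ih] with t hφ G H ν μ h
    simp only [TL.eval, hφ G H ν μ h]
  | app p f hf φ ih =>
    filter_upwards [eventually_all.2 ih] with t hφ G H ν μ h
    simp only [TL.eval, hφ _ G H ν μ h]
  | sum x φ ih =>
    obtain ⟨T, hT⟩ := eventually_atTop.1 ih
    filter_upwards [eventually_ge_atTop (T + 1)] with t ht G H ν μ h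
    obtain ⟨s, rfl⟩ : ∃ s, t = s + 1 := ⟨t - 1, by omega⟩
    obtain ⟨e, he⟩ := h.exists_update x
    simp only [TL.eval]
    exact Fintype.sum_equiv e _ _ fun u => hT s (by omega) G H _ _ (he u)

theorem agreeUpTo_const (hk : 1 ≤ k) {t : ℕ} {G H : LabeledGraph n ℓ} {v w : Fin n}
    (h₀ : vwl k 0 (G, v) = vwl k 0 (H, w)) (h : vwl k t (G, v) = vwl k t (H, w)) :
    AgreeUpTo t G H (fun _ : Fin (k + 1) => v) (fun _ => w) := by
  -- `1 ≤ k` matters: only then does the label of the constant `k`-tuple record the colour of `v`.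
  have h₀' : atp G (fun _ : Fin k => v) = atp H (fun _ => w) := h₀
  exact ⟨atp_comp h₀' fun _ => ⟨0, hk⟩, fun _ => h⟩

/-! ### Operations on expressions -/

/-- Renaming of the index variables, free and bound, along a permutation. -/
def TL.rename {X : Type} (σ : Equiv.Perm X) : TL Ω ℓ X → TL Ω ℓ X
  | .eq x y => .eq (σ x) (σ y)
  | .ne x y => .ne (σ x) (σ y)
  | .edge x y => .edge (σ x) (σ y)
  | .pred s x => .pred s (σ x)
  | .mul φ ψ => .mul (φ.rename σ) (ψ.rename σ)
  | .plus φ ψ => .plus (φ.rename σ) (ψ.rename σ)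
  | .scale a φ => .scale a (φ.rename σ)
  | .app p f hf φ => .app p f hf fun i => (φ i).rename σ
  | .sum x φ => .sum (σ x) (φ.rename σ)

theorem TL.eval_rename {X : Type} [DecidableEq X] (σ : Equiv.Perm X) (G : LabeledGraph n ℓ)
    (φ : TL Ω ℓ X) (ν : X → Fin n) : (φ.rename σ).eval G ν = φ.eval G (ν ∘ σ) := by
  induction φ generalizing ν with
  | sum x φ ih =>
    simp only [TL.rename, TL.eval, ih]
    refine Finset.sum_congr rfl fun u _ => ?_
    rw [update_comp_eq_of_injective _ σ.injective]
  | _ => simp_all [TL.rename, TL.eval]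

theorem exists_eval_update (φ : TLVar Ω ℓ (k + 1)) {i : Fin (k + 1)} (hi : i ≠ 0) :
    ∃ ψ : TLVar Ω ℓ (k + 1), ψ.free ⊆ insert 0 (φ.free \ {i}) ∧
      ∀ (G : LabeledGraph n ℓ) (ν : Fin (k + 1) → Fin n),
        ψ.eval G ν = φ.eval G (update ν i (ν 0)) := by
  refine ⟨.sum i (.mul (.eq 0 i) φ), fun x hx => ?_, fun G ν => ?_⟩
  · simp only [TL.free, Set.mem_sdiff, Set.mem_union, Set.mem_insert_iff,
      Set.mem_singleton_iff] at hx ⊢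
    tauto
  · simp [TL.eval, update_of_ne hi.symm, ind]

/-- The value of an expression at constant tuples is given by an expression in which only `x_1`
is free. -/
theorem exists_diagonal (φ : TLVar Ω ℓ (k + 1)) :
    ∃ ψ : TLVar Ω ℓ (k + 1), ψ.free ⊆ {0} ∧
      ∀ (G : LabeledGraph n ℓ) (ν : Fin (k + 1) → Fin n),
        ψ.eval G ν = φ.eval G fun _ => ν 0 := by
  have key (s : Finset (Fin (k + 1))) (hs : 0 ∉ s) :
      ∃ ψ : TLVar Ω ℓ (k + 1), ψ.free ⊆ {i | i ∉ s} ∧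
        ∀ (G : LabeledGraph n ℓ) (ν : Fin (k + 1) → Fin n),
          ψ.eval G ν = φ.eval G fun i => if i ∈ s then ν 0 else ν i := by
    induction s using Finset.induction_on with
    | empty => exact ⟨φ, by simp, by simp⟩
    | insert i s his ih =>
      rw [Finset.mem_insert, not_or] at hs
      obtain ⟨ψ, hψ, hev⟩ := ih hs.2
      obtain ⟨χ, hχ, hev'⟩ := exists_eval_update (n := n) ψ (Ne.symm hs.1)
      refine ⟨χ, fun x hx => ?_, fun G ν => ?_⟩
      · rcases hχ hx with rfl | ⟨hx, hxi⟩
        · simpa using hs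
        · simpa using ⟨hxi, hψ hx⟩
      · rw [hev', hev]
        congr 1
        ext j
        by_cases hj : j = i
        · subst hj
          simp [his]
        · simp [hj, update_of_ne hs.1]
  obtain ⟨ψ, hψ, hev⟩ := key (Finset.univ.erase 0) (by simp)
  refine ⟨ψ, fun x hx => by simpa using hψ hx, fun G ν => ?_⟩
  rw [hev]
  congr 1
  ext j
  by_cases hj : j = 0 <;> simp [hj]

/-! ### Indicator functions in algebras of functions on a finite set -/

/-- A subalgebra of the real functions on a finite set contains the indicator functions of the
classes of points that it does not separate. -/
theorem exists_mem_indicator {X : Type*} [Finite X] (A : Subalgebra ℝ (X → ℝ)) (p : X) :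
    ∃ f ∈ A, (∀ q, (∀ g ∈ A, g p = g q) → f q = 1) ∧ ∀ q, ¬ (∀ g ∈ A, g p = g q) → f q = 0 := by
  classical
  have := Fintype.ofFinite X
  have hsep (q : X) : ∃ f ∈ A, f p = 1 ∧ (¬ (∀ g ∈ A, g p = g q) → f q = 0) := by
    by_cases h : ∀ g ∈ A, g p = g q
    · exact ⟨1, A.one_mem, rfl, fun h' => (h' h).elim⟩
    · push Not at h
      obtain ⟨g, hg, hne⟩ := h
      refine ⟨(g p - g q)⁻¹ • (g - algebraMap ℝ (X → ℝ) (g q)),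
        A.smul_mem (A.sub_mem hg (A.algebraMap_mem _)) _, ?_, fun _ => ?_⟩
      · simp [sub_ne_zero.2 hne]
      · simp
  choose f hfA hfp hfq using hsep
  have hprod : ∏ q, f q ∈ A := A.prod_mem fun q _ => hfA q
  refine ⟨_, hprod, fun q hq => ?_, fun q hq => ?_⟩
  · rw [← hq _ hprod]
    simp [hfp]
  · rw [Finset.prod_apply]
    exact Finset.prod_eq_zero (Finset.mem_univ q) (hfq q hq)

/-! ### Tuples that no expression separates -/

variable (k Ω) in
/-- The functions, on the `(k + 1)`-tuples of vertices of the graphs of a family, that expressions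
define. Constants are multiples of the expression `1_{x_1 = x_1}`. -/
noncomputable def evalAlgebra {ι : Type} (G : ι → LabeledGraph n ℓ) :
    Subalgebra ℝ (ι × (Fin (k + 1) → Fin n) → ℝ) where
  carrier := Set.range fun (φ : TLVar Ω ℓ (k + 1)) p => φ.eval (G p.1) p.2
  mul_mem' := by
    rintro _ _ ⟨φ, rfl⟩ ⟨ψ, rfl⟩
    exact ⟨.mul φ ψ, rfl⟩
  add_mem' := by
    rintro _ _ ⟨φ, rfl⟩ ⟨ψ, rfl⟩
    exact ⟨.plus φ ψ, rfl⟩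
  algebraMap_mem' r := ⟨.scale r (.eq 0 0), by ext; simp [TL.eval, ind]⟩

variable (Ω) in
/-- No expression separates the tuple `ν` of vertices of `G` from the tuple `μ` of vertices
of `H`. -/
def Inseparable (G H : LabeledGraph n ℓ) (ν μ : Fin (k + 1) → Fin n) : Prop :=
  ∀ φ : TLVar Ω ℓ (k + 1), φ.eval G ν = φ.eval H μ

namespace Inseparable

variable {G H : LabeledGraph n ℓ} {ν μ : Fin (k + 1) → Fin n}

theorem atp_eq (h : Inseparable Ω G H ν μ) : atp G ν = atp H μ :=
  atp_eq_iff.2 ⟨fun i j => ind_eq_ind.1 (h (.eq i j)), fun i j => ind_eq_ind.1 (h (.edge i j)),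
    fun i => funext fun s => h (.pred s i)⟩

theorem comp_perm (h : Inseparable Ω G H ν μ) (σ : Equiv.Perm (Fin (k + 1))) :
    Inseparable Ω G H (ν ∘ σ) (μ ∘ σ) := fun φ => by
  rw [← TL.eval_rename, ← TL.eval_rename, h]

theorem exists_update (h : Inseparable Ω G H ν μ) (i : Fin (k + 1)) :
    ∃ e : Equiv.Perm (Fin n), ∀ u, Inseparable Ω G H (update ν i u) (update μ i (e u)) := by
  classical
  let 𝒢 : Bool → LabeledGraph n ℓ := fun b => cond b G H
  let S : Setoid (Bool × (Fin (k + 1) → Fin n)) :=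
    { r := fun p q => ∀ g ∈ evalAlgebra k Ω 𝒢, g p = g q
      iseqv := ⟨fun _ _ _ => rfl, fun h g hg => (h g hg).symm,
        fun h₁ h₂ g hg => (h₁ g hg).trans (h₂ g hg)⟩ }
  have hmap : (Finset.univ : Finset (Fin n)).val.map
        (fun u => (⟦(true, update ν i u)⟧ : Quotient S)) =
      (Finset.univ : Finset (Fin n)).val.map (fun u => ⟦(false, update μ i u)⟧) := by
    ext c
    obtain ⟨p, rfl⟩ := Quotient.exists_rep c
    obtain ⟨_, ⟨φ, rfl⟩, h₁, h₀⟩ := exists_mem_indicator (evalAlgebra k Ω 𝒢) p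
    have hφ (q : Bool × (Fin (k + 1) → Fin n)) :
        φ.eval (𝒢 q.1) q.2 = if (⟦p⟧ : Quotient S) = ⟦q⟧ then 1 else 0 := by
      split_ifs with hq
      · exact h₁ q (Quotient.exact hq)
      · exact h₀ q fun hq' => hq (Quotient.sound hq')
    -- The sum of the indicator over `x_{i+1}` counts the occurrences of the class of `p`.
    have hsum := h (.sum i φ)
    simp only [TL.eval] at hsum
    have hG := fun u => hφ (true, update ν i u)
    have hH := fun u => hφ (false, update μ i u)
    simp only [𝒢, cond_true, cond_false] at hG hH
    simp only [hG, hH, Finset.sum_boole, Nat.cast_inj] at hsum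
    rw [Multiset.count_map, Multiset.count_map]
    exact hsum
  obtain ⟨e, he⟩ := multiset_map_univ_eq_iff.1 hmap
  refine ⟨e, fun u φ => ?_⟩
  exact Quotient.exact (he u) _ ⟨φ, rfl⟩

theorem wl_eq (h : Inseparable Ω G H ν μ) (t : ℕ) :
    wl k G t (Fin.init ν) = wl k H t (Fin.init μ) := by
  induction t generalizing ν μ with
  | zero => exact atp_comp h.atp_eq Fin.castSucc
  | succ t ih =>
    obtain ⟨e, he⟩ := h.exists_update (Fin.last k)
    refine wl_succ_eq_iff.2 ⟨ih h, e, fun u => ?_⟩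
    have hu := he u
    rw [update_last, update_last] at hu
    refine ⟨hu.atp_eq, fun j => ?_⟩
    simpa [init_comp_swap_last] using ih (hu.comp_perm (Equiv.swap j.castSucc (Fin.last k)))

end Inseparable

end TensorLang

open TensorLang in
theorem theorem1 (n ℓ k : ℕ) (hk : 1 ≤ k) (Ω : TensorLang.FunCollection) :
    TensorLang.rho {⟨(t : ℕ) → TensorLang.WLLabel k ℓ t,
        (TensorLang.vwlStable k : TensorLang.PointedGraph n ℓ → _)⟩} =
      TensorLang.rho (TensorLang.representedFunctions n ℓ Ω k) := by
  ext ⟨G, v⟩ ⟨H, w⟩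
  constructor
  · rintro h _ ⟨d, f, ⟨φ, -, hf⟩, rfl⟩
    have hwl (t : ℕ) : vwl k t (G, v) = vwl k t (H, w) := congrFun (h _ rfl) t
    funext i
    obtain ⟨t, ht⟩ := (eventually_eval_eq (n := n) (φ i)).exists
    calc f (G, v) i = (φ i).eval G fun _ => v := hf G v _ rfl i
      _ = (φ i).eval H fun _ => w := ht _ _ _ _ (agreeUpTo_const hk (hwl 0) (hwl t))
      _ = f (H, w) i := (hf H w _ rfl i).symm
  · rintro h _ rfl
    have hins : Inseparable Ω G H (fun _ : Fin (k + 1) => v) (fun _ => w) := fun φ => by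
      obtain ⟨ψ, hψ, hev⟩ := exists_diagonal (n := n) φ
      have := h ⟨Fin 1 → ℝ, fun p _ => ψ.eval p.1 fun _ => p.2⟩
        ⟨1, _, ⟨fun _ => ψ, fun _ => hψ, fun G v ν hν _ => ?_⟩, rfl⟩
      · simpa [hev] using congrFun this 0
      · simp [hev, hν]
    exact funext fun t => hins.wl_eq t
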